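/- Let $\sigma:\mathbb{R}\to\mathbb{R}$ be continuous, and differentiable with $\sigma'(t_0)\neq 0$ at some $t_0\in\mathbb{R}$. A feedforward network $\hat f:\mathbb{R}^n\to\mathbb{R}^N$ with activation $\sigma$ is a map obtained by composing finitely many hidden layers $x\mapsto\sigma(Ax+b)$ ($\sigma$ applied coordinatewise) with a linear output layer $x\mapsto Ax$; its width is the largest dimension of its layers, input and output included. For $w\in\mathbb{R}^N$ and an $N\times m$ matrix $Y$ with rows $Y_1,\dots,Y_N\in\mathbb{R}^m$, put $$\operatorname{P-attention}(w,Y)=\sum_{k=1}^N\frac{e^{w_k}}{\sum_{j=1}^N e^{w_j}}\,\delta_{Y_k}.$$ For a measure $\mu$, a set $B\subseteq\mathbb{R}^m$ and a point $y\in\mathbb{R}^m$ write $\mathcal{W}_1(\mu,B)=\inf_{b\in B}\mathcal{W}_1(\mu,\delta_b)$, with $\mathcal{W}_1$ the Wasserstein-1 distance for the Euclidean norm, and $\|y-B\|=\inf_{b\in B}\|y-b\|$. Let $K\subseteq\mathbb{R}^m$ be non-empty and compact. Let $C$ assign to each $x\in\mathbb{R}^n$ a closed set $C_x\subseteq\mathbb{R}^m$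 with $C_x\cap K\neq\emptyset$, such that $\{x: C_x\cap U\neq\emptyset\}$ is Borel for every relatively open $U\subseteq K$. Let $L:\mathbb{R}^n\times\mathbb{R}^m\to\mathbb{R}$ be continuous in its second argument and Borel measurable in its first (for example, jointly continuous). Let $\mathbb{P}$ be a Borel probability measure on $\mathbb{R}^n$ and let $0<\epsilon\leq 1$. Write $\mathcal{O}(x)=\operatorname{argmin}_{y\in C_x\cap K}L(x,y)$. Then there are $N\geq 1$, a feedforward network $\hat f:\mathbb{R}^n\to\mathbb{R}^N$ with activation $\sigma$ of width at most $2+n+N$, an $N\times m$ matrix $Y$ and a non-empty compact set $\mathcal{X}_\epsilon\subseteq\mathbb{R}^n$ such that $\hat F(x)=\operatorname{P-attention}(\hat f(x),Y)$ satisfies 1. $\bigcup_{x\in\mathbb{R}^n}\operatorname{supp}\hat F(x)\subseteq K$, 2. $\mathcal{W}_1(\hat F(x),\mathcal{O}(x))\leq\epsilon$ for every $x\in\mathcal{X}_\epsilon$, 3. $1-\mathbb{P}(\mathcal{X}_\epsilon)\leq\epsilon$. Moreover, for all $N\ge 1$, $\hat f$ of width at most $2+n+N$, $Y$ and compact $\mathcal{X}_\epsilon$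 with properties 1--3, and for every family $\{Y^x\}_{x\in\mathbb{R}^n}$ of $K$-valued random vectors on a probability space with $Y^x\sim\hat F(x)$ for each $x\in\mathbb{R}^n$, one has $1-\mathbb{P}(\mathcal{X}_\epsilon)\leq\epsilon$ and $$\mathbb{E}\big[\,\|Y^x-\mathcal{O}(x)\|\,\big]\leq\epsilon\qquad\text{for every }x\in\mathcal{X}_\epsilon.$$ -/

import Mathlib

open MeasureTheory ProbabilityTheory

open scoped ENNReal

noncomputable section

/-- The Euclidean space `ℝ^d`, with the Euclidean norm and its Borel sigma-algebra. -/
abbrev Euc (d : ℕ) : Type := EuclideanSpace ℝ (Fin d)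

/-- The condition on the activation function: `σ` is continuous, and it is differentiable
with nonzero derivative at some point. -/
def IsAdmissibleActivation (σ : ℝ → ℝ) : Prop :=
  Continuous σ ∧ ∃ t₀ : ℝ, DifferentiableAt ℝ σ t₀ ∧ deriv σ t₀ ≠ 0

/-- The parameters of a feedforward network with `p` inputs and `q` outputs: finitely many hidden
layers, each with a weight matrix `A` and a bias `b`, followed by a linear output layer. -/
inductive FeedforwardNet : ℕ → ℕ → Type
  | output {p q : ℕ} (A : Matrix (Fin q) (Fin p) ℝ) : FeedforwardNet p q
  | hidden {p d q : ℕ} (A : Matrix (Fin d) (Fin p) ℝ) (b : Fin d → ℝ)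
      (rest : FeedforwardNet d q) : FeedforwardNet p q

namespace FeedforwardNet

/-- The function computed by a network with activation `σ`: a hidden layer maps `x` to
`σ (A x + b)`, with `σ` applied to each coordinate, and the output layer maps `x` to `A x`. -/
def eval (σ : ℝ → ℝ) : {p q : ℕ} → FeedforwardNet p q → (Fin p → ℝ) → (Fin q → ℝ)
  | _, _, output A, x => A.mulVec x
  | _, _, hidden A b rest, x => rest.eval σ (fun i => σ (A.mulVec x i + b i))

/-- The width of a network: the largest dimension of its layers, input and output included. -/
def width : {p q : ℕ} → FeedforwardNet p q → ℕ
  | p, q, output _ => max p q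
  | p, _, hidden _ _ rest => max p rest.width

end FeedforwardNet

/-- The softmax function on `ℝ^N`. -/
def softmax {N : ℕ} (w : Fin N → ℝ) (k : Fin N) : ℝ :=
  Real.exp (w k) / ∑ j, Real.exp (w j)

/-- Probabilistic attention: the measure `∑ k, softmax(w)_k δ_{Y_k}`, where `Y 0, …, Y (N - 1)`
are the rows of an `N × m` matrix. -/
def pAttention {N m : ℕ} (w : Fin N → ℝ) (Y : Fin N → Euc m) : Measure (Euc m) :=
  ∑ k, ENNReal.ofReal (softmax w k) • Measure.dirac (Y k)

/-- The probabilistic transformer `x ↦ P-attention(f̂(x), Y)`. -/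
def probTransformer (σ : ℝ → ℝ) {n m N : ℕ} (f : FeedforwardNet n N) (Y : Fin N → Euc m)
    (x : Euc n) : Measure (Euc m) :=
  pAttention (f.eval σ x.ofLp) Y

/-- The Wasserstein-1 distance: the infimum of the mean transport cost over all couplings. -/
def W1 {m : ℕ} (μ ν : Measure (Euc m)) : ℝ≥0∞ :=
  ⨅ π ∈ {π : Measure (Euc m × Euc m) | π.map Prod.fst = μ ∧ π.map Prod.snd = ν},
    ∫⁻ z, ENNReal.ofReal ‖z.1 - z.2‖ ∂π

/-- The distance of a measure to a set of points: `inf_{b ∈ B} W1(μ, δ_b)`. -/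
def W1ToSet {m : ℕ} (μ : Measure (Euc m)) (B : Set (Euc m)) : ℝ≥0∞ :=
  ⨅ b ∈ B, W1 μ (Measure.dirac b)

/-- The set of minimizers of `g` on `S`. -/
def argminOn {α : Type*} (g : α → ℝ) (S : Set α) : Set α :=
  {y | y ∈ S ∧ ∀ z ∈ S, g y ≤ g z}

/-- Weak measurability of the correspondence `C`: for every relatively open subset `U ∩ K` of `K`,
the set of the points `x` such that `C x` meets `U ∩ K` is Borel. -/
def IsWeaklyMeasurable {n m : ℕ} (K : Set (Euc m)) (C : Euc n → Set (Euc m)) : Prop :=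
  ∀ U : Set (Euc m), IsOpen U → MeasurableSet {x | (C x ∩ (U ∩ K)).Nonempty}

/-- The guarantees of the Deep Maximum Theorem for `N`, the network `f`, the matrix `Y` and the
compact set `X` at accuracy `ε`. -/
structure IsDeepMaximizer {n m : ℕ} (σ : ℝ → ℝ) (K : Set (Euc m)) (C : Euc n → Set (Euc m))
    (L : Euc n → Euc m → ℝ) (P : Measure (Euc n)) (ε : ℝ)
    {N : ℕ} (f : FeedforwardNet n N) (Y : Fin N → Euc m) (X : Set (Euc n)) : Prop where
  pos : 0 < N
  width_le : f.width ≤ 2 + n + N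
  support_subset : ⋃ x, (probTransformer σ f Y x).support ⊆ K
  isCompact : IsCompact X
  W1_le : ∀ x ∈ X, W1ToSet (probTransformer σ f Y x) (argminOn (L x) (C x ∩ K)) ≤ ENNReal.ofReal ε
  prob_ge : 1 - P.real X ≤ ε

end

open Filter Topology

/-! Choose a measurable `K`-valued `g` with `g x` within `ε/8` of a minimizer. By an approximate
Lusin theorem, `g` is `ε/8`-close to a continuous `h` on a compact `X` of large measure. Take a fine
finite net `z k` of `X` and let the rows of the matrix be `g (z k)`, which lie in `K`. Softmax
ignores a common shift of the logits, so the affine logits `c * (2⟪z k, x⟫ - ‖z k‖²)` act as `-c *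
‖x - z k‖²`. For large `c` the weight concentrates on net points near `x`, where `g (z k)` is close
to `g x`. One hidden layer approximates these affine logits.

For the random vectors, a coupling with `δ_b` pays at least the distance to any set containing `b`,
so `W1ToSet` bounds the mean distance. -/

theorem IsWeaklyMeasurable.measurableSet_exists_le {n m : ℕ} {K : Set (Euc m)}
    {C : Euc n → Set (Euc m)} (hK : IsCompact K) (hCmeas : IsWeaklyMeasurable K C)
    (hC : ∀ x, IsClosed (C x)) {g : Euc n → Euc m → ℝ} (hg : ∀ x, Continuous (g x))
    (hgm : ∀ y, Measurable fun x => g x y) :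
    MeasurableSet {x | ∃ y ∈ C x ∩ K, g x y ≤ 0} := by
  set q := TopologicalSpace.denseSeq (Euc m)
  have hq : DenseRange q := TopologicalSpace.denseRange_denseSeq _
  let r : ℕ → ℝ := fun j => 1 / ((j : ℝ) + 1)
  have hr : ∀ j, 0 < r j := fun j => Nat.one_div_pos_of_nat
  have hr0 : Tendsto r atTop (𝓝 0) := tendsto_one_div_add_atTop_nhds_zero_nat
  -- Testing `g` only at countably many fixed points keeps every set measurable; compactness of `K`
  -- recovers an exact solution in the limit.
  have key : {x | ∃ y ∈ C x ∩ K, g x y ≤ 0} = ⋂ j, ⋃ i,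
      ({x | (C x ∩ (Metric.ball (q i) (r j) ∩ K)).Nonempty} ∩ {x | g x (q i) < r j}) := by
    ext x
    simp only [Set.mem_iInter, Set.mem_iUnion, Set.mem_ofPred_eq, Set.mem_inter_iff]
    constructor
    · rintro ⟨y, ⟨hyC, hyK⟩, hy⟩ j
      have ho : IsOpen (Metric.ball y (r j) ∩ {z | g x z < r j}) :=
        Metric.isOpen_ball.inter (isOpen_lt (hg x) continuous_const)
      obtain ⟨i, hi⟩ := hq.exists_mem_open ho
        ⟨y, Metric.mem_ball_self (hr j), lt_of_le_of_lt hy (hr j)⟩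
      exact ⟨i, ⟨y, hyC, by rw [Metric.mem_ball']; exact hi.1, hyK⟩, hi.2⟩
    · intro h
      choose i hi hgi using h
      choose p hp using hi
      obtain ⟨y, hyK, φ, hφ, hlim⟩ := hK.tendsto_subseq fun j => (hp j).2.2
      have hdist : Tendsto (fun j => dist (q (i j)) (p j)) atTop (𝓝 0) :=
        squeeze_zero (fun _ => dist_nonneg)
          (fun j => by rw [dist_comm]; exact (Metric.mem_ball.1 (hp j).2.1).le) hr0
      have hlim' : Tendsto (fun j => q (i (φ j))) atTop (𝓝 y) :=
        (tendsto_iff_of_dist (hdist.comp hφ.tendsto_atTop)).2 hlim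
      refine ⟨y, ⟨(hC x).mem_of_tendsto hlim (Eventually.of_forall fun j => (hp _).1), hyK⟩, ?_⟩
      exact le_of_tendsto_of_tendsto (((hg x).tendsto y).comp hlim')
        (hr0.comp hφ.tendsto_atTop) (Eventually.of_forall fun j => (hgi (φ j)).le)
  rw [key]
  exact MeasurableSet.iInter fun j => MeasurableSet.iUnion fun i =>
    (hCmeas _ Metric.isOpen_ball).inter (measurableSet_lt (hgm _) measurable_const)

theorem argminOn_nonempty {m : ℕ} {S : Set (Euc m)} (hS : IsCompact S) (hne : S.Nonempty)
    {g : Euc m → ℝ} (hg : Continuous g) : (argminOn g S).Nonempty := by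
  obtain ⟨y, hy, hmin⟩ := hS.exists_isMinOn hne hg.continuousOn
  exact ⟨y, hy, fun z hz => hmin hz⟩

theorem IsWeaklyMeasurable.measurableSet_argminOn_inter_closedBall {n m : ℕ} {K : Set (Euc m)}
    {C : Euc n → Set (Euc m)} (hK : IsCompact K) (hCmeas : IsWeaklyMeasurable K C)
    (hC : ∀ x, IsClosed (C x)) (hCK : ∀ x, (C x ∩ K).Nonempty)
    {L : Euc n → Euc m → ℝ} (hL : ∀ x, Continuous (L x))
    (hLm : ∀ y, Measurable fun x => L x y) (c : Euc m) (r : ℝ) :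
    MeasurableSet {x | ∃ y ∈ argminOn (L x) (C x ∩ K), dist y c ≤ r} := by
  choose s hs using fun x => argminOn_nonempty (hK.inter_left (hC x)) (hCK x) (hL x)
  -- The selection `s` need not be measurable, but the minimum value is: its sublevel sets are
  -- feasibility sets.
  have hM : Measurable fun x => L x (s x) := by
    refine measurable_of_Iic fun a => ?_
    convert hCmeas.measurableSet_exists_le hK hC (g := fun x y => L x y - a)
      (fun x => (hL x).sub continuous_const) (fun y => (hLm y).sub_const a) using 1
    ext x
    simp only [Set.mem_preimage, Set.mem_Iic, Set.mem_ofPred_eq, sub_nonpos]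
    exact ⟨fun h => ⟨s x, (hs x).1, h⟩, fun ⟨y, hy, h⟩ => ((hs x).2 y hy).trans h⟩
  convert hCmeas.measurableSet_exists_le hK hC
    (g := fun x y => max (L x y - L x (s x)) (dist y c - r))
    (fun x => by have := hL x; fun_prop)
    (fun y => ((hLm y).sub hM).max measurable_const) using 1
  ext x
  simp only [Set.mem_ofPred_eq, max_le_iff, sub_nonpos]
  exact ⟨fun ⟨y, hy, h⟩ => ⟨y, hy.1, hy.2 _ (hs x).1, h⟩,
    fun ⟨y, hy, h, h'⟩ => ⟨y, ⟨hy, fun z hz => h.trans ((hs x).2 z hz)⟩, h'⟩⟩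

/-- An approximate measurable selection of the minimizers. -/
theorem IsWeaklyMeasurable.exists_measurable_near_argminOn {n m : ℕ} {K : Set (Euc m)}
    {C : Euc n → Set (Euc m)} (hK : IsCompact K) (hCmeas : IsWeaklyMeasurable K C)
    (hC : ∀ x, IsClosed (C x)) (hCK : ∀ x, (C x ∩ K).Nonempty)
    {L : Euc n → Euc m → ℝ} (hL : ∀ x, Continuous (L x))
    (hLm : ∀ y, Measurable fun x => L x y) {r : ℝ} (hr : 0 < r) :
    ∃ g : Euc n → Euc m, Measurable g ∧ (∀ x, g x ∈ K) ∧
      ∀ x, ∃ y ∈ argminOn (L x) (C x ∩ K), dist y (g x) ≤ r := by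
  classical
  have : Nonempty K := (hCK 0).elim fun y hy => ⟨⟨y, hy.2⟩⟩
  set q := TopologicalSpace.denseSeq K
  have hq : DenseRange q := TopologicalSpace.denseRange_denseSeq _
  have hex : ∀ x, ∃ i, ∃ y ∈ argminOn (L x) (C x ∩ K), dist y (q i) ≤ r := fun x => by
    obtain ⟨y, hy⟩ := argminOn_nonempty (hK.inter_left (hC x)) (hCK x) (hL x)
    obtain ⟨i, hi⟩ := hq.exists_dist_lt ⟨y, hy.1.2⟩ hr
    exact ⟨i, y, hy, hi.le⟩
  refine ⟨fun x => q (Nat.find (hex x)), ?_, fun x => (q _).2, fun x => Nat.find_spec (hex x)⟩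
  exact (measurable_from_nat (f := fun i => (q i : Euc m))).comp (measurable_find hex fun i =>
    hCmeas.measurableSet_argminOn_inter_closedBall hK hC hCK hL hLm (q i) r)

/-- An approximate Lusin theorem: a bounded measurable function is close to a continuous one
on a compact set of large measure. -/
theorem exists_isCompact_dist_continuous_lt {n m : ℕ} (P : Measure (Euc n)) [IsProbabilityMeasure P]
    {g : Euc n → Euc m} (hg : Measurable g) {K : Set (Euc m)} (hK : IsCompact K)
    (hgK : ∀ x, g x ∈ K) {r ε : ℝ} (hr : 0 < r) (hε : 0 < ε) :
    ∃ (h : Euc n → Euc m) (X : Set (Euc n)), Continuous h ∧ IsCompact X ∧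
      1 - P.real X ≤ ε ∧ ∀ x ∈ X, dist (g x) (h x) < r := by
  obtain ⟨D, hD⟩ := hK.isBounded.exists_norm_le
  have hgi : Integrable g P :=
    .of_bound hg.aestronglyMeasurable D (ae_of_all _ fun x => hD _ (hgK x))
  obtain ⟨h, hh, hhi⟩ := hgi.exists_boundedContinuous_integral_sub_le
    (show 0 < r * (ε / 2) by positivity)
  -- Markov's inequality spends `ε / 2`; inner regularity spends the other half.
  have hmark := mul_meas_ge_le_integral_of_nonneg (μ := P) (f := fun x => ‖g x - h x‖)
    (ae_of_all _ fun x => norm_nonneg _) (hgi.sub hhi).norm r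
  have hB : P.real {x | r ≤ ‖g x - h x‖} ≤ ε / 2 := le_of_mul_le_mul_left (hmark.trans hh) hr
  have hAm : MeasurableSet {x | r ≤ ‖g x - h x‖} :=
    measurableSet_le measurable_const (hg.sub h.continuous.measurable).norm
  obtain ⟨X, hXs, hX, hPX⟩ := hAm.compl.exists_isCompact_lt_add (measure_ne_top P _)
    (ε := ENNReal.ofReal (ε / 2)) (by simpa using hε)
  refine ⟨h, X, h.continuous, hX, ?_, fun x hx => ?_⟩
  · have h1 : P.real {x | r ≤ ‖g x - h x‖}ᶜ ≤ P.real X + ε / 2 := by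
      have := ENNReal.toReal_mono (by finiteness) hPX.le
      rwa [ENNReal.toReal_add (by finiteness) (by finiteness),
        ENNReal.toReal_ofReal (by positivity)] at this
    rw [probReal_compl_eq_one_sub hAm] at h1
    linarith
  · simpa [dist_eq_norm] using hXs hx

theorem softmax_nonneg {N : ℕ} (w : Fin N → ℝ) (k : Fin N) : 0 ≤ softmax w k := by
  unfold softmax; positivity

theorem sum_softmax {N : ℕ} (w : Fin N → ℝ) (k₀ : Fin N) : ∑ k, softmax w k = 1 := by
  have h : 0 < ∑ j, Real.exp (w j) := Finset.sum_pos (fun j _ => Real.exp_pos _) ⟨k₀, by simp⟩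
  simp only [softmax]
  rw [← Finset.sum_div, div_self h.ne']

theorem softmax_le_exp_sub {N : ℕ} (w : Fin N → ℝ) (k k₀ : Fin N) :
    softmax w k ≤ Real.exp (w k - w k₀) := by
  rw [Real.exp_sub]
  unfold softmax
  gcongr
  exact Finset.single_le_sum (f := fun j => Real.exp (w j)) (fun j _ => (Real.exp_pos _).le)
    (Finset.mem_univ k₀)

theorem pAttention_support_subset {N m : ℕ} (w : Fin N → ℝ) (Y : Fin N → Euc m)
    {K : Set (Euc m)} (hK : IsClosed K) (hY : ∀ k, Y k ∈ K) : (pAttention w Y).support ⊆ K := by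
  refine Measure.support_subset_of_isClosed hK ?_
  rw [mem_ae_iff]
  simp [pAttention, Measure.dirac_apply' _ hK.measurableSet.compl, hY]

theorem lintegral_pAttention {N m : ℕ} (w : Fin N → ℝ) (Y : Fin N → Euc m)
    (f : Euc m → ℝ≥0∞) :
    ∫⁻ y, f y ∂(pAttention w Y) = ∑ k, ENNReal.ofReal (softmax w k) * f (Y k) := by
  simp [pAttention]

theorem W1_dirac_le {m : ℕ} (μ : Measure (Euc m)) [IsProbabilityMeasure μ] (b : Euc m) :
    W1 μ (Measure.dirac b) ≤ ∫⁻ y, ENNReal.ofReal ‖y - b‖ ∂μ := by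
  have h1 : (μ.map fun y => (y, b)).map Prod.fst = μ := by
    rw [Measure.map_map measurable_fst (by fun_prop)]
    exact Measure.map_id
  have h2 : (μ.map fun y => (y, b)).map Prod.snd = Measure.dirac b := by
    rw [Measure.map_map measurable_snd (by fun_prop)]
    simp [Function.comp_def, Measure.map_const]
  refine (iInf₂_le (μ.map fun y => (y, b)) ⟨h1, h2⟩).trans ?_
  rw [lintegral_map (by fun_prop) (by fun_prop)]

theorem isProbabilityMeasure_pAttention {N m : ℕ} (w : Fin N → ℝ) (Y : Fin N → Euc m)
    (k₀ : Fin N) : IsProbabilityMeasure (pAttention w Y) := by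
  constructor
  simp [pAttention, ← ENNReal.ofReal_sum_of_nonneg fun k _ => softmax_nonneg w k,
    sum_softmax w k₀]

theorem W1ToSet_pAttention_le {N m : ℕ} (w : Fin N → ℝ) (Y : Fin N → Euc m) (k₀ : Fin N)
    {B : Set (Euc m)} {b : Euc m} (hb : b ∈ B) {r : ℝ}
    (h : ∑ k, softmax w k * ‖Y k - b‖ ≤ r) : W1ToSet (pAttention w Y) B ≤ ENNReal.ofReal r := by
  have := isProbabilityMeasure_pAttention w Y k₀
  refine (iInf₂_le b hb).trans ((W1_dirac_le _ b).trans ?_)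
  rw [lintegral_pAttention]
  simp_rw [← ENNReal.ofReal_mul (softmax_nonneg w _)]
  rw [← ENNReal.ofReal_sum_of_nonneg
    fun k _ => mul_nonneg (softmax_nonneg w k) (norm_nonneg _)]
  exact ENNReal.ofReal_le_ofReal h

/-- Every coupling with `δ_b` has second coordinate almost surely `b`, so its cost dominates the
integral pointwise. -/
theorem lintegral_infEDist_le_W1ToSet {m : ℕ} (μ : Measure (Euc m)) (B : Set (Euc m)) :
    ∫⁻ y, Metric.infEDist y B ∂μ ≤ W1ToSet μ B := by
  refine le_iInf₂ fun b hb => le_iInf₂ ?_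
  rintro π ⟨rfl, h2⟩
  have hae : ∀ᵐ z ∂π, z.2 = b := by
    have : ∀ᵐ y ∂(π.map Prod.snd), y = b := by
      rw [h2]; exact (ae_dirac_iff (measurableSet_singleton b)).2 rfl
    exact ae_of_ae_map measurable_snd.aemeasurable this
  rw [lintegral_map Metric.continuous_infEDist.measurable measurable_fst]
  refine lintegral_mono_ae ?_
  filter_upwards [hae] with z hz
  rw [hz, ← dist_eq_norm, ← edist_dist]
  exact Metric.infEDist_le_edist_of_mem hb

/-- Shallow networks approximate affine maps uniformly on bounded sets. -/
theorem IsAdmissibleActivation.exists_net_near_affine {σ : ℝ → ℝ} (hσ : IsAdmissibleActivation σ)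
    {n N : ℕ} (A : Matrix (Fin N) (Fin n) ℝ) (b : Fin N → ℝ) (R : ℝ) {τ : ℝ} (hτ : 0 < τ) :
    ∃ f : FeedforwardNet n N, f.width ≤ 2 + n + N ∧ ∀ x : Fin n → ℝ, (∀ i, |x i| ≤ R) →
      ∀ k, |f.eval σ x k - (A.mulVec x k + b k)| ≤ τ := by
  obtain ⟨-, t₀, hd, hne⟩ := hσ
  set s := deriv σ t₀
  -- A hidden neuron with zero weights and bias `c` outputs the constant `σ c`; it replaces the bias
  -- that the output layer lacks.
  obtain ⟨c, hc⟩ : ∃ c, σ c ≠ 0 := by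
    by_contra! h
    obtain rfl : σ = fun _ => 0 := funext h
    simp [s] at hne
  set S := ∑ k, ∑ i, |A k i|
  have hS : 0 ≤ S := by positivity
  set R' := max R 1
  have hR' : 0 < R' := lt_of_lt_of_le one_pos (le_max_right _ _)
  set η := τ * |s| / ((S + 1) * R')
  have hs : 0 < |s| := abs_pos.2 hne
  have hη : 0 < η := by positivity
  obtain ⟨δ, hδ, hlin⟩ : ∃ δ > 0, ∀ h : ℝ, |h| < δ → |σ (t₀ + h) - σ t₀ - h * s| ≤ η * |h| := by
    have := (hasDerivAt_iff_isLittleO_nhds_zero.1 hd.hasDerivAt).def hη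
    obtain ⟨δ, hδ, h⟩ := Metric.eventually_nhds_iff.1 this
    exact ⟨δ, hδ, fun t ht => by simpa using h (y := t) (by simpa using ht)⟩
  set α := δ / (2 * R')
  have hα : 0 < α := by positivity
  -- A difference quotient at `t₀` approximates the identity in each coordinate.
  let u : (Fin n → ℝ) → Fin n → ℝ := fun x i => (σ (t₀ + α * x i) - σ t₀) / (α * s)
  have hu : ∀ x : Fin n → ℝ, (∀ i, |x i| ≤ R) → ∀ i, |u x i - x i| ≤ τ / (S + 1) := by
    intro x hx i
    have hxi : |x i| ≤ R' := (hx i).trans (le_max_left _ _)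
    have hsmall : |α * x i| < δ := by
      rw [abs_mul, abs_of_pos hα]
      calc α * |x i| ≤ α * R' := by gcongr
        _ = δ / 2 := by simp only [α]; field_simp
        _ < δ := half_lt_self hδ
    have h1 : u x i - x i = (σ (t₀ + α * x i) - σ t₀ - α * x i * s) / (α * s) := by
      simp only [u]; field_simp
    rw [h1, abs_div, div_le_iff₀ (by positivity), abs_mul, abs_of_pos hα]
    calc _ ≤ η * |α * x i| := hlin _ hsmall
      _ ≤ η * (α * R') := by rw [abs_mul, abs_of_pos hα]; gcongr
      _ = τ / (S + 1) * (α * |s|) := by simp only [η]; field_simp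
  refine ⟨.hidden (d := n + 1)
    (Matrix.of (Fin.cons 0 fun i j => if i = j then α else 0)) (Fin.cons c fun _ => t₀)
    (.output (Matrix.of fun k => Fin.cons ((b k - ∑ i, A k i * (σ t₀ / (α * s))) / σ c)
      fun i => A k i / (α * s))), ?_, ?_⟩
  · simp only [FeedforwardNet.width]; omega
  · intro x hx k
    have he : ∀ i, A k i / (α * s) * σ (α * x i + t₀) =
        A k i * u x i + A k i * (σ t₀ / (α * s)) := fun i => by
      simp only [u]; rw [add_comm]; field_simp; ring
    have h2 : FeedforwardNet.eval σ (.hidden (d := n + 1)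
        (Matrix.of (Fin.cons 0 fun i j => if i = j then α else 0)) (Fin.cons c fun _ => t₀)
        (.output (Matrix.of fun k => Fin.cons ((b k - ∑ i, A k i * (σ t₀ / (α * s))) / σ c)
          fun i => A k i / (α * s)))) x k - (A.mulVec x k + b k) =
        ∑ i, A k i * (u x i - x i) := by
      simp [FeedforwardNet.eval, Matrix.mulVec, dotProduct, Fin.sum_univ_succ, ite_mul, he,
        Finset.sum_add_distrib, mul_sub, hc]
      ring
    rw [h2]
    calc |∑ i, A k i * (u x i - x i)| ≤ ∑ i, |A k i| * (τ / (S + 1)) := by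
          refine (Finset.abs_sum_le_sum_abs _ _).trans (Finset.sum_le_sum fun i _ => ?_)
          rw [abs_mul]; gcongr; exact hu x hx i
      _ = (∑ i, |A k i|) * (τ / (S + 1)) := (Finset.sum_mul _ _ _).symm
      _ ≤ (S + 1) * (τ / (S + 1)) := by
          gcongr
          have := Finset.single_le_sum (f := fun k => ∑ i, |A k i|)
            (fun _ _ => by positivity) (Finset.mem_univ k)
          simp only [S]; linarith
      _ = τ := by field_simp

/-- Networks followed by the softmax function select the points of a net close to `x`. -/
theorem IsAdmissibleActivation.exists_net_softmax_le {σ : ℝ → ℝ} (hσ : IsAdmissibleActivation σ)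
    {n N : ℕ} {X : Set (Euc n)} (hX : Bornology.IsBounded X) (z : Fin N → Euc n) {s δ : ℝ}
    (hs : 0 < s) (hδ : 0 < δ) (hz : ∀ x ∈ X, ∃ k, dist x (z k) < s / 2) :
    ∃ f : FeedforwardNet n N, f.width ≤ 2 + n + N ∧ ∀ x ∈ X, ∀ k, s ≤ dist x (z k) →
      softmax (f.eval σ x.ofLp) k ≤ δ := by
  obtain ⟨R, hR⟩ := hX.exists_norm_le
  -- `3/4 * s²` is the gap `s² - (s/2)²` between far and near net points; the `2` absorbs an error
  -- of `1` in each of two logits.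
  obtain ⟨c, hc, hcδ⟩ : ∃ c : ℝ, 0 < c ∧ Real.exp (2 - c * (3 / 4 * s ^ 2)) ≤ δ := by
    refine ⟨max 1 ((2 - Real.log δ) / (3 / 4 * s ^ 2)), by positivity, ?_⟩
    rw [← Real.le_log_iff_exp_le hδ]
    have := (div_le_iff₀ (by positivity)).1 (le_max_right 1 ((2 - Real.log δ) / (3 / 4 * s ^ 2)))
    linarith
  obtain ⟨f, hf, hfx⟩ := hσ.exists_net_near_affine (Matrix.of fun k i => c * (2 * z k i))
    (fun k => -(c * ‖z k‖ ^ 2)) R one_pos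
  refine ⟨f, hf, fun x hx k hk => ?_⟩
  obtain ⟨k₀, hk₀⟩ := hz x hx
  have hlog : ∀ k, (Matrix.of fun k i => c * (2 * z k i)).mulVec x.ofLp k + -(c * ‖z k‖ ^ 2) =
      c * ‖x‖ ^ 2 - c * dist x (z k) ^ 2 := fun k => by
    rw [dist_eq_norm, norm_sub_sq_real, PiLp.inner_apply]
    simp only [Matrix.mulVec, dotProduct, Matrix.of_apply, RCLike.inner_apply, conj_trivial,
      mul_assoc, ← Finset.mul_sum]
    ring
  have hb : ∀ i, |x.ofLp i| ≤ R := fun i => (PiLp.norm_apply_le x i).trans (hR x hx)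
  have h1 := abs_le.1 (hlog k ▸ hfx x.ofLp hb k)
  have h2 := abs_le.1 (hlog k₀ ▸ hfx x.ofLp hb k₀)
  refine (softmax_le_exp_sub _ k k₀).trans ((Real.exp_le_exp.2 ?_).trans hcδ)
  have h3 : 3 / 4 * s ^ 2 ≤ dist x (z k) ^ 2 - dist x (z k₀) ^ 2 := by
    have h4 : s ^ 2 ≤ dist x (z k) ^ 2 := by gcongr
    have h5 : dist x (z k₀) ^ 2 ≤ (s / 2) ^ 2 := by gcongr
    linarith
  nlinarith [mul_le_mul_of_nonneg_left h3 hc.le]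

theorem sum_softmax_mul_le {N : ℕ} (w : Fin N → ℝ) (k₀ : Fin N) {d : Fin N → ℝ} {r D δ : ℝ}
    (hr : 0 ≤ r) (hD : 0 ≤ D) (hδ : 0 ≤ δ) (hd : ∀ k, d k ≤ D)
    (h : ∀ k, d k ≤ r ∨ softmax w k ≤ δ) : ∑ k, softmax w k * d k ≤ r + N * (D * δ) := by
  calc ∑ k, softmax w k * d k ≤ ∑ k, (softmax w k * r + D * δ) := by
        refine Finset.sum_le_sum fun k _ => ?_
        have h0 := softmax_nonneg w k
        rcases h k with h | h
        · have := mul_le_mul_of_nonneg_left h h0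
          have : 0 ≤ D * δ := by positivity
          linarith
        · have h1 := mul_le_mul_of_nonneg_left (hd k) h0
          have h2 := mul_le_mul_of_nonneg_right h hD
          have : 0 ≤ softmax w k * r := by positivity
          linarith
    _ = r + N * (D * δ) := by
        rw [Finset.sum_add_distrib, ← Finset.sum_mul, sum_softmax w k₀]; simp

theorem mainTheorem6 {n m : ℕ} (σ : ℝ → ℝ) (hσ : IsAdmissibleActivation σ)
    (K : Set (Euc m)) (hKne : K.Nonempty) (hKcomp : IsCompact K)
    (C : Euc n → Set (Euc m)) (hCmeas : IsWeaklyMeasurable K C)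
    (hCclosed : ∀ x, IsClosed (C x)) (hCK : ∀ x, (C x ∩ K).Nonempty)
    (L : Euc n → Euc m → ℝ) (hLcont : ∀ x, Continuous (L x))
    (hLmeas : ∀ y, Measurable fun x => L x y)
    (P : Measure (Euc n)) [IsProbabilityMeasure P]
    (ε : ℝ) (hε0 : 0 < ε) (hε1 : ε ≤ 1) :
    (∃ (N : ℕ) (f : FeedforwardNet n N) (Y : Fin N → Euc m) (X : Set (Euc n)),
      X.Nonempty ∧ IsDeepMaximizer σ K C L P ε f Y X) ∧
    ∀ (N : ℕ) (f : FeedforwardNet n N) (Y : Fin N → Euc m) (X : Set (Euc n)),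
      IsDeepMaximizer σ K C L P ε f Y X →
      ∀ (Ω : Type*) [MeasurableSpace Ω] (ν : Measure Ω) [IsProbabilityMeasure ν]
        (R : Euc n → Ω → Euc m),
        (∀ x ω, R x ω ∈ K) →
        (∀ x, HasLaw (R x) (probTransformer σ f Y x) ν) →
        1 - P.real X ≤ ε ∧
        ∀ x ∈ X, ∫⁻ ω, Metric.infEDist (R x ω) (argminOn (L x) (C x ∩ K)) ∂ν
          ≤ ENNReal.ofReal ε := by
  refine ⟨?_, ?_⟩
  · obtain ⟨g, hg, hgK, hgnear⟩ := hCmeas.exists_measurable_near_argminOn hKcomp hCclosed hCK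
      hLcont hLmeas (show 0 < ε / 8 by positivity)
    -- With `ε / 2` in place of `ε`, `X` has positive measure even when `ε = 1`, hence is non-empty.
    obtain ⟨h, X, hh, hX, hPX, hgh⟩ := exists_isCompact_dist_continuous_lt P hg hKcomp hgK
      (show 0 < ε / 8 by positivity) (half_pos hε0)
    have hXne : X.Nonempty := by
      rw [Set.nonempty_iff_ne_empty]
      rintro rfl
      simp at hPX
      linarith
    obtain ⟨s, hs, hunif⟩ := Metric.uniformContinuousOn_iff.1
      (hX.uniformContinuousOn_of_continuous hh.continuousOn) (ε / 8) (by positivity)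
    obtain ⟨t, htX, htfin, hcover⟩ := hX.finite_cover_balls (half_pos hs)
    obtain ⟨N, z, -, rfl⟩ := htfin.fin_param
    have hzX : ∀ k, z k ∈ X := fun k => htX ⟨k, rfl⟩
    have hcov : ∀ x ∈ X, ∃ k, dist x (z k) < s / 2 := fun x hx => by
      simpa using hcover hx
    obtain ⟨k₀, -⟩ := hcov _ hXne.some_mem
    obtain ⟨D, hD⟩ := Metric.isBounded_iff.1 hKcomp.isBounded
    have hD0 : 0 ≤ D := dist_nonneg.trans (hD (hgK 0) (hgK 0))
    obtain ⟨f, hf, hfX⟩ := hσ.exists_net_softmax_le hX.isBounded z hs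
      (show 0 < ε / 2 / (N * D + 1) by positivity) hcov
    refine ⟨N, f, fun k => g (z k), X, hXne, ⟨k₀.pos, hf, ?_, hX, ?_, by linarith⟩⟩
    · exact Set.iUnion_subset fun x =>
        pAttention_support_subset _ _ hKcomp.isClosed fun k => hgK _
    · intro x hx
      obtain ⟨b, hb, hbx⟩ := hgnear x
      refine W1ToSet_pAttention_le _ _ k₀ hb ((sum_softmax_mul_le _ k₀ (half_pos hε0).le hD0
        (show 0 ≤ ε / 2 / (N * D + 1) by positivity) (fun k => ?_) fun k => ?_).trans ?_)
      · rw [← dist_eq_norm]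
        exact hD (hgK _) hb.1.2
      · by_cases hk : s ≤ dist x (z k)
        · exact Or.inr (hfX x hx k hk)
        · left
          have h1 := hunif x hx (z k) (hzX k) (not_le.1 hk)
          have h2 := hgh x hx
          have h3 := hgh _ (hzX k)
          rw [← dist_eq_norm]
          rw [dist_comm] at h1 hbx
          -- Four errors of `ε / 8` give `ε / 2`; far net points contribute the other half.
          have h4 := dist_triangle4 (g (z k)) (h (z k)) (h x) (g x)
          have h5 := dist_triangle (g (z k)) (g x) b
          rw [dist_comm (h x)] at h4
          linarith
      · have : N * (D * (ε / 2 / (N * D + 1))) ≤ ε / 2 := by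
          rw [← mul_assoc, ← mul_div_assoc, div_le_iff₀ (by positivity)]
          nlinarith
        linarith
  · intro N f Y X hF Ω _ ν _ R _ hR
    refine ⟨hF.prob_ge, fun x hx => ?_⟩
    calc ∫⁻ ω, Metric.infEDist (R x ω) (argminOn (L x) (C x ∩ K)) ∂ν
        = ∫⁻ y, Metric.infEDist y (argminOn (L x) (C x ∩ K)) ∂(probTransformer σ f Y x) := by
          rw [← (hR x).map_eq, lintegral_map' Metric.continuous_infEDist.aemeasurable
            (hR x).aemeasurable]
      _ ≤ _ := lintegral_infEDist_le_W1ToSet _ _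
      _ ≤ _ := hF.W1_le x hx
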